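/- Let $\mathcal X$ be a complex Hilbert space with scalar product $(\cdot,\cdot)$ linear in the first argument. Let $U$ be a (possibly unbounded) selfadjoint operator in $\mathcal X$ that is positive definite, i.e. $(U\psi,\psi)\ge m\|\psi\|^2$ on $D(U)$ for some $m>0$. Let $V$ and $\delta V$ be linear operators in $\mathcal X$ whose domains contain $D(U)$ and which are symmetric on $D(U)$. Then $A=VU^{-1}$ and $\delta A=\delta V\,U^{-1}$ are bounded. Let $b,c$ be real numbers with $$\|A\|\le b<1,\qquad \|\delta A\|\le c .$$ On $\mathcal Q=D(U^{1/2})\times D(U^{1/2})$ consider the form of the Klein-Gordon Hamiltonian with potential $V$, $$\mathfrak g(\psi,\varphi)=(U^{1/2}\psi_1,U^{1/2}\varphi_1)+(U^{1/2}\psi_2,U^{1/2}\varphi_2)+(U^{1/2}\psi_2,VU^{-1/2}\varphi_1)+(VU^{-1/2}\psi_1,U^{1/2}\varphi_2),$$ and its perturbation $$\delta\mathfrak g(\psi,\varphi)=(U^{1/2}\psi_2,\delta V\,U^{-1/2}\varphi_1)+(\delta V\,U^{-1/2}\psi_1,U^{1/2}\varphi_2).$$ Both forms are symmetric, $\mathfrak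 g(\psi,\psi)>0$ for $\psi\neq0$, and $\mathfrak g+\delta\mathfrak g$ is the form of the Klein-Gordon Hamiltonian with potential $V+\delta V$. We say that $\delta\mathfrak g$ is a small perturbation of $\mathfrak g$ with constant $\kappa$ if $|\delta\mathfrak g(\psi,\psi)|\le\kappa\,\mathfrak g(\psi,\psi)$ for all $\psi\in\mathcal Q$ and $\kappa<1$. In (1)-(5) the estimates are for all $0\ne\psi\in\mathcal Q$. Put $$D=-(I-A^*A)^{-1/2}(\delta A^*A+A^*\delta A)(I-A^*A)^{-1/2}.$$ 1. If $a\in\mathbb R$ and $-aI\le D\le aI$, then $$\frac{|\delta\mathfrak g(\psi,\psi)|}{\mathfrak g(\psi,\psi)}\le\frac a2+\sqrt{\Big(\frac a2\Big)^2+\frac{c^2}{1-b^2}} .$$ 2. The choice $a=\frac{2bc}{1-b^2}$ satisfies $-aI\le D\le aI$, and the right-hand side in (1) then equals $\frac{c}{1-b}$; so $\frac{|\delta\mathfrak g(\psi,\psi)|}{\mathfrak g(\psi,\psi)}\le\frac{c}{1-b}$. If $b+c<1$, then $\frac c{1-b}\le c+b<1$, and $\delta\mathfrak g$ is a small perturbation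 with constant $\frac{c}{1-b}$, and hence also with $\kappa=c+b$. 3. If $\nu\ge0$ and $\|\delta V\psi\|\le\nu\|V\psi\|$ for all $\psi\in D(U)$, then $\frac{|\delta\mathfrak g(\psi,\psi)|}{\mathfrak g(\psi,\psi)}\le\kappa=\frac{\nu b}{1-b}$. Here $\kappa<1$ if and only if $b+\nu b<1$, and in that case $\delta\mathfrak g$ is a small perturbation with constant $\kappa$. 4. If $V$ and $\delta V$ have disjoint supports in the sense that $(\delta V\psi,V\psi)=0$ for all $\psi\in D(U)$, then $\frac{|\delta\mathfrak g(\psi,\psi)|}{\mathfrak g(\psi,\psi)}\le\kappa=\frac{c}{\sqrt{1-b^2}}$. Here $\kappa<1$ if and only if $b^2+c^2<1$, and in that case $\delta\mathfrak g$ is a small perturbation with constant $\kappa$. 5. If $V\delta V\le0$ in the sense that $\delta A^*A+A^*\delta A\le0$, then $$-\frac{c}{\sqrt{1-b^2}}\le\frac{\delta\mathfrak g(\psi,\psi)}{\mathfrak g(\psi,\psi)}\le\frac{c}{1-b}.$$ Moreover, put $\kappa_-=-\frac{c}{\sqrt{1-b^2}}$, $\kappa_+=\frac c{1-b}$, $\kappa_0=\frac{\kappa_++\kappa_-}2$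 and $\kappa'=\frac{\kappa_+-\kappa_-}{2+\kappa_++\kappa_-}$. Then $\kappa_0\ge0$ and $\kappa'\le\kappa_+$; if $b,c>0$, then $\kappa_0\ne0$ and $\kappa'<\kappa_+$; and if $b^2+c^2<1$, then $\delta\mathfrak g-\kappa_0\mathfrak g$ is a small perturbation of $(1+\kappa_0)\mathfrak g$ with constant $\kappa'$. -/

import Mathlib

open scoped InnerProductSpace ComplexOrder

namespace KleinGordon

variable {X : Type*} [NormedAddCommGroup X] [InnerProductSpace ℂ X] [CompleteSpace X]

/-- `U` is a (generally unbounded) positive definite selfadjoint operator: it is selfadjoint and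
its quadratic form is bounded below by a positive constant (so that `U⁻¹` is bounded). -/
structure IsPosDef (U : X →ₗ.[ℂ] X) : Prop where
  selfAdjoint : IsSelfAdjoint U
  coercive : ∃ m : ℝ, 0 < m ∧ ∀ x : U.domain, m * ‖(x : X)‖ ^ 2 ≤ (⟪(x : X), U x⟫_ℂ).re

/-- `V` is an admissible potential with respect to `U`: `D(V) ⊇ D(U)` and `V` is symmetric
on `D(U)`. -/
structure IsPotential (U V : X →ₗ.[ℂ] X) : Prop where
  dom : U.domain ≤ V.domain
  symm : ∀ x y : U.domain,
    ⟪V ⟨x, dom x.2⟩, (y : X)⟫_ℂ = ⟪(x : X), V ⟨y, dom y.2⟩⟫_ℂ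

section Inverse

variable {U : X →ₗ.[ℂ] X}

theorem IsPosDef.symm (hU : IsPosDef U) (x y : U.domain) :
    ⟪U x, (y : X)⟫_ℂ = ⟪(x : X), U y⟫_ℂ := by
  have h := LinearPMap.adjoint_isFormalAdjoint (T := U) hU.selfAdjoint.dense_domain
  rw [LinearPMap.isSelfAdjoint_def.mp hU.selfAdjoint] at h
  exact h x y

theorem IsPosDef.exists_le_norm (hU : IsPosDef U) :
    ∃ m : ℝ, 0 < m ∧ ∀ x : U.domain, m * ‖(x : X)‖ ≤ ‖U x‖ := by
  obtain ⟨m, hm, h⟩ := hU.coercive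
  refine ⟨m, hm, fun x => ?_⟩
  have h1 := h x
  have h2 : (⟪(x : X), U x⟫_ℂ).re ≤ ‖(x : X)‖ * ‖U x‖ := re_inner_le_norm (𝕜 := ℂ) (x : X) (U x)
  rcases (norm_nonneg (x : X)).eq_or_lt with h0 | h0
  · rw [← h0, mul_zero]; exact norm_nonneg _
  · nlinarith

theorem IsPosDef.injective (hU : IsPosDef U) : Function.Injective U.toFun := by
  obtain ⟨m, hm, h⟩ := hU.exists_le_norm
  refine (injective_iff_map_eq_zero _).mpr fun x hx => ?_
  have h1 := h x
  have h2 : U x = 0 := hx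
  rw [h2, norm_zero] at h1
  have h3 : ‖(x : X)‖ ≤ 0 := by
    by_contra hc
    push Not at hc
    nlinarith
  exact Subtype.ext (norm_le_zero_iff.mp h3)

theorem IsPosDef.surjective (hU : IsPosDef U) : Function.Surjective U.toFun := by
  obtain ⟨m, hm, h⟩ := hU.exists_le_norm
  have hcl : IsClosed (LinearMap.range U.toFun : Set X) := by
    refine IsSeqClosed.isClosed fun u y hu hy => ?_
    choose x hx using hu
    have hx' : ∀ n, U (x n) = u n := hx
    have hcau : CauchySeq fun n => (x n : X) := by
      have hc := hy.cauchySeq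
      rw [Metric.cauchySeq_iff] at hc ⊢
      intro ε hε
      obtain ⟨N, hN⟩ := hc (m * ε) (by positivity)
      refine ⟨N, fun p hp q hq => ?_⟩
      have h1 := hN p hp q hq
      have h2 := h (x p - x q)
      rw [LinearPMap.map_sub, hx', hx'] at h2
      rw [dist_eq_norm] at h1 ⊢
      have h3 : m * ‖(x p : X) - x q‖ < m * ε := lt_of_le_of_lt h2 h1
      exact lt_of_mul_lt_mul_left h3 hm.le
    obtain ⟨z, hz⟩ := cauchySeq_tendsto_of_complete hcau
    have hmem : (z, y) ∈ (U.graph : Set (X × X)) := by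
      refine (show _root_.IsClosed (U.graph : Set (X × X)) from
        hU.selfAdjoint.isClosed).mem_of_tendsto (hz.prodMk_nhds hy) (Filter.Eventually.of_forall fun n => ?_)
      exact (LinearPMap.mem_graph_iff U).mpr ⟨x n, rfl, hx' n⟩
    obtain ⟨w, -, hw⟩ := (LinearPMap.mem_graph_iff U).mp hmem
    exact ⟨w, hw⟩
  have horth : (LinearMap.range U.toFun)ᗮ = ⊥ := by
    rw [Submodule.eq_bot_iff]
    intro y hy
    rw [Submodule.mem_orthogonal] at hy
    have hy' : ∀ x : U.domain, ⟪(0 : X), x⟫_ℂ = ⟪y, U x⟫_ℂ := fun x => by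
      rw [inner_zero_left, ← inner_conj_symm, hy (U x) ⟨x, rfl⟩, map_zero]
    have hdom : y ∈ U.domain := by
      have h1 := LinearPMap.mem_adjoint_domain_of_exists (T := U) y ⟨0, hy'⟩
      rwa [LinearPMap.isSelfAdjoint_def.mp hU.selfAdjoint] at h1
    have h0 : U ⟨y, hdom⟩ = 0 := by
      have hd := hU.selfAdjoint.dense_domain
      refine hd.eq_zero_of_inner_left (𝕜 := ℂ) fun v hv => ?_
      have h1 := hU.symm ⟨y, hdom⟩ ⟨v, hv⟩
      rw [h1, ← hy' ⟨v, hv⟩, inner_zero_left]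
    have h1 := h ⟨y, hdom⟩
    rw [h0, norm_zero] at h1
    have h3 : ‖y‖ ≤ 0 := by
      by_contra hc
      push Not at hc
      have : 0 < m * ‖y‖ := by positivity
      exact absurd h1 (not_le.mpr this)
    exact norm_le_zero_iff.mp h3
  have htop : LinearMap.range U.toFun = ⊤ := by
    have : CompleteSpace (LinearMap.range U.toFun) := hcl.completeSpace_coe
    exact Submodule.orthogonal_eq_bot_iff.mp horth
  exact LinearMap.range_eq_top.mp htop

/-- The linear bijection `U : D(U) → X`. -/
noncomputable def equivOf (hU : IsPosDef U) : U.domain ≃ₗ[ℂ] X :=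
  LinearEquiv.ofBijective U.toFun ⟨hU.injective, hU.surjective⟩

/-- The bounded inverse `U⁻¹`, everywhere defined on `X`. -/
noncomputable def invU (hU : IsPosDef U) : X →L[ℂ] X :=
  { toLinearMap := U.domain.subtype ∘ₗ (equivOf hU).symm.toLinearMap
    cont := by
      obtain ⟨m, hm, h⟩ := hU.exists_le_norm
      refine AddMonoidHomClass.continuous_of_bound
        (U.domain.subtype ∘ₗ (equivOf hU).symm.toLinearMap) m⁻¹ fun x => ?_
      have h1 := h ((equivOf hU).symm x)
      have h2 : U ((equivOf hU).symm x) = x := (equivOf hU).apply_symm_apply x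
      rw [h2] at h1
      rw [inv_mul_eq_div, le_div_iff₀ hm, mul_comm]
      exact h1 }

theorem invU_mem (hU : IsPosDef U) (x : X) : invU hU x ∈ U.domain :=
  ((equivOf hU).symm x).2

theorem apply_invU (hU : IsPosDef U) (x : X) : U ⟨invU hU x, invU_mem hU x⟩ = x :=
  (equivOf hU).apply_symm_apply x

theorem invU_nonneg (hU : IsPosDef U) : 0 ≤ invU hU := by
  rw [ContinuousLinearMap.nonneg_iff_isPositive, ContinuousLinearMap.isPositive_def]
  refine ⟨?_, fun x => ?_⟩
  · intro x y
    have h := hU.symm ⟨invU hU x, invU_mem hU x⟩ ⟨invU hU y, invU_mem hU y⟩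
    rw [apply_invU, apply_invU] at h
    exact h.symm
  · obtain ⟨m, hm, h⟩ := hU.coercive
    have h1 := h ⟨invU hU x, invU_mem hU x⟩
    rw [apply_invU] at h1
    exact le_trans (by positivity) h1

/-- The bounded operator `U^{-1/2}`, the positive square root of `U⁻¹`. -/
noncomputable def invSqrtU (hU : IsPosDef U) : X →L[ℂ] X := CFC.sqrt (invU hU)

/-- The operator `U^{1/2}`, the inverse of `U^{-1/2}`; its domain is the range of `U^{-1/2}`. -/
noncomputable def sqrtU (hU : IsPosDef U) : X →ₗ.[ℂ] X :=
  ((invSqrtU hU : X →ₗ[ℂ] X).toPMap ⊤).inverse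

theorem invSqrtU_invSqrtU (hU : IsPosDef U) (x : X) :
    invSqrtU hU (invSqrtU hU x) = invU hU x :=
  congrArg (fun T : X →L[ℂ] X => T x) (CFC.sqrt_mul_sqrt_self (invU hU) (invU_nonneg hU))

theorem mem_sqrtU_domain (hU : IsPosDef U) {x : X} :
    x ∈ (sqrtU hU).domain ↔ ∃ y, invSqrtU hU y = x := by
  rw [sqrtU, LinearPMap.inverse_domain]
  constructor
  · rintro ⟨y, hy⟩
    exact ⟨y, hy⟩
  · rintro ⟨y, hy⟩
    exact ⟨⟨y, trivial⟩, hy⟩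

theorem invSqrtU_injective (hU : IsPosDef U) : Function.Injective (invSqrtU hU) := by
  intro x y hxy
  have h : invU hU x = invU hU y := by
    rw [← invSqrtU_invSqrtU, hxy, invSqrtU_invSqrtU]
  have h2 := apply_invU hU x
  have h3 : (⟨invU hU x, invU_mem hU x⟩ : U.domain) = ⟨invU hU y, invU_mem hU y⟩ := Subtype.ext h
  rw [h3, apply_invU] at h2
  exact h2.symm

/-- `U^{1/2}` is inverse to `U^{-1/2}`. -/
theorem invSqrtU_sqrtU (hU : IsPosDef U) (x : (sqrtU hU).domain) :
    invSqrtU hU (sqrtU hU x) = x := by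
  obtain ⟨y, hy⟩ := (mem_sqrtU_domain hU).mp x.2
  have hker : ((invSqrtU hU : X →ₗ[ℂ] X).toPMap ⊤).toFun.ker = ⊥ := by
    rw [LinearMap.ker_eq_bot]
    intro a b hab
    exact Subtype.ext (invSqrtU_injective hU hab)
  have h : sqrtU hU x = y :=
    LinearPMap.inverse_apply_eq (f := (invSqrtU hU : X →ₗ[ℂ] X).toPMap ⊤) hker
      (y := x) (x := ⟨y, trivial⟩) hy
  rw [h, hy]

/-- `U^{-1/2}` maps the form domain `D(U^{1/2})` into `D(U)`. -/
theorem invSqrtU_mem (hU : IsPosDef U) (x : (sqrtU hU).domain) :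
    invSqrtU hU (x : X) ∈ U.domain := by
  obtain ⟨y, hy⟩ := (mem_sqrtU_domain hU).mp x.2
  rw [← hy, invSqrtU_invSqrtU]
  exact invU_mem hU y

end Inverse

section Potential

variable {U V W : X →ₗ.[ℂ] X}

/-- The operator `V U⁻¹`. It is everywhere defined, and bounded by the closed graph theorem. -/
noncomputable def relOp (hU : IsPosDef U) (hV : IsPotential U V) : X →L[ℂ] X :=
  ContinuousLinearMap.ofSeqClosedGraph
    (g := V.toFun ∘ₗ LinearMap.codRestrict V.domain (invU hU : X →ₗ[ℂ] X)
      fun x => hV.dom (invU_mem hU x)) <| by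
    intro u x y hu hy
    have hd := hU.selfAdjoint.dense_domain
    refine hd.eq_of_inner_left (𝕜 := ℂ) fun v hv => ?_
    have key : ∀ z : X, ⟪(V.toFun ∘ₗ LinearMap.codRestrict V.domain (invU hU : X →ₗ[ℂ] X)
        fun x => hV.dom (invU_mem hU x)) z, v⟫_ℂ = ⟪invU hU z, V ⟨v, hV.dom hv⟩⟫_ℂ := fun z =>
      hV.symm ⟨invU hU z, invU_mem hU z⟩ ⟨v, hv⟩
    have h1 := hy.inner (tendsto_const_nhds (x := v)) (𝕜 := ℂ)
    have h2 := (((invU hU).continuous.tendsto x).comp hu).inner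
      (tendsto_const_nhds (x := V ⟨v, hV.dom hv⟩)) (𝕜 := ℂ)
    rw [key x]
    refine tendsto_nhds_unique h1 (h2.congr fun n => ?_)
    exact (key (u n)).symm

theorem relOp_apply (hU : IsPosDef U) (hV : IsPotential U V) (x : X) :
    relOp hU hV x = V ⟨invU hU x, hV.dom (invU_mem hU x)⟩ := rfl

/-- The perturbed potential `V + W` is again an admissible potential. -/
theorem IsPotential.add (hV : IsPotential U V) (hW : IsPotential U W) :
    IsPotential U (V + W) where
  dom := fun _ hx => ⟨hV.dom hx, hW.dom hx⟩
  symm := fun x y => by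
    rw [LinearPMap.add_apply, LinearPMap.add_apply, inner_add_left, inner_add_right]
    exact congrArg₂ (· + ·) (hV.symm x y) (hW.symm x y)

/-- The common form domain `D(U^{1/2}) × D(U^{1/2})` of all the forms below. -/
abbrev FormDom (hU : IsPosDef U) : Type _ := (sqrtU hU).domain × (sqrtU hU).domain

/-- The free form `𝔤₀(ψ,φ) = (U^{1/2}ψ₁, U^{1/2}φ₁) + (U^{1/2}ψ₂, U^{1/2}φ₂)`.
Here `(x, y)` is linear in `x`, i.e. it is `⟪y, x⟫_ℂ`. -/
noncomputable def freeForm (hU : IsPosDef U) (ψ φ : FormDom hU) : ℂ :=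
  ⟪sqrtU hU φ.1, sqrtU hU ψ.1⟫_ℂ + ⟪sqrtU hU φ.2, sqrtU hU ψ.2⟫_ℂ

/-- The form generated by a potential,
`𝔳(ψ,φ) = (U^{1/2}ψ₂, V U^{-1/2}φ₁) + (V U^{-1/2}ψ₁, U^{1/2}φ₂)`. -/
noncomputable def potForm (hU : IsPosDef U) (hV : IsPotential U V) (ψ φ : FormDom hU) : ℂ :=
  ⟪V ⟨invSqrtU hU φ.1, hV.dom (invSqrtU_mem hU φ.1)⟩, sqrtU hU ψ.2⟫_ℂ +
    ⟪sqrtU hU φ.2, V ⟨invSqrtU hU ψ.1, hV.dom (invSqrtU_mem hU ψ.1)⟩⟫_ℂ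

/-- The form `𝔤 = 𝔤₀ + 𝔳` of the Klein-Gordon Hamiltonian with potential `V`. -/
noncomputable def kgForm (hU : IsPosDef U) (hV : IsPotential U V) (ψ φ : FormDom hU) : ℂ :=
  freeForm hU ψ φ + potForm hU hV ψ φ

end Potential

/-- The relative size `δg(ψ,ψ) / g(ψ,ψ)` of a perturbation `δg` of a form `g`
(both are real on the diagonal for symmetric forms). -/
noncomputable def formRatio {Q : Type*} (δg g : Q → Q → ℂ) (ψ : Q) : ℝ :=
  (δg ψ ψ).re / (g ψ ψ).re

/-- `|δg| ≤ κ g` with `κ < 1`: the smallness condition under which `g + δg` is an admissible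
perturbation of the positive definite form `g`. -/
def SmallPert {Q : Type*} (δg g : Q → Q → ℂ) (κ : ℝ) : Prop :=
  κ < 1 ∧ ∀ ψ, ‖δg ψ ψ‖ ≤ κ * (g ψ ψ).re

/-- The bounded selfadjoint operator
`-(I - A⋆A)^{-1/2} (δA⋆ A + A⋆ δA) (I - A⋆A)^{-1/2}`, for `‖A‖ < 1`. -/
noncomputable def diagBlock (A δA : X →L[ℂ] X) : X →L[ℂ] X :=
  -((1 - star A * A) ^ (-(1 / 2) : ℝ) * (star δA * A + star A * δA) *
    (1 - star A * A) ^ (-(1 / 2) : ℝ))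

end KleinGordon

open KleinGordon

/-! Put `x = U^{1/2}ψ₁`, `y = U^{1/2}ψ₂`, `u = A x`, `v = δA x`. Completing the square gives `g = p²
+ q²` with `p² = ‖x‖² - ‖u‖²` and `q = ‖y + u‖`, while `δg = 2 Re⟪y + u, v⟫ - 2 Re⟪u, v⟫`. Since
`‖v‖ ≤ c‖x‖ ≤ s p` with `s² = c²/(1-b²)`, a bound `a p²` on the last term leaves `δg ≤ a p² + 2 s p
q`, controlled by the top eigenvalue of a 2×2 matrix (`quadratic_le_eigenvalue`,
`re_inner_le_of_diag_le`). Substituting `x = (1 - A⋆A)^{-1/2} w` turns `p²` into `‖w‖²`, so the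
bounds `±a` on `diagBlock` say exactly that `|2 Re⟪u, v⟫| ≤ a p²` (`diagBlock_bounds_iff`). The
special cases are choices of `a`: Cauchy-Schwarz gives `2bc/(1-b²)`; orthogonality, or a sign for
one of the two sides, gives `0`. -/

namespace KleinGordon

variable {X : Type*} [NormedAddCommGroup X] [InnerProductSpace ℂ X]

/-! ### Pointwise estimates for vectors -/

/-- The larger eigenvalue of the matrix `[[a, s], [s, 0]]` bounds its quadratic form. -/
theorem quadratic_le_eigenvalue (a t p q : ℝ) (ht : 0 ≤ t) :
    a * p ^ 2 + 2 * √t * p * q ≤ (a / 2 + √((a / 2) ^ 2 + t)) * (p ^ 2 + q ^ 2) := by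
  set r := √((a / 2) ^ 2 + t) with hr
  have hr2 : r ^ 2 = (a / 2) ^ 2 + t := Real.sq_sqrt (by positivity)
  have habs : |a / 2| ≤ r := Real.abs_le_sqrt (by linarith)
  have h1 : 0 ≤ r - a / 2 := by linarith [le_abs_self (a / 2)]
  have h2 : 0 ≤ r + a / 2 := by linarith [neg_abs_le (a / 2)]
  have h3 : √(r - a / 2) * √(r + a / 2) = √t := by
    rw [← Real.sqrt_mul h1]
    congr 1
    linarith [show (r - a / 2) * (r + a / 2) = r ^ 2 - (a / 2) ^ 2 by ring]
  have h4 := sq_nonneg (√(r - a / 2) * p - √(r + a / 2) * q)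
  have h5 : (√(r - a / 2) * p - √(r + a / 2) * q) ^ 2
      = √(r - a / 2) ^ 2 * p ^ 2 - 2 * (√(r - a / 2) * √(r + a / 2)) * p * q
        + √(r + a / 2) ^ 2 * q ^ 2 := by ring
  rw [h5, h3, Real.sq_sqrt h1, Real.sq_sqrt h2] at h4
  linarith

theorem norm_sq_complete (x y u : X) :
    ‖x‖ ^ 2 + ‖y‖ ^ 2 + 2 * (⟪y, u⟫_ℂ).re = (‖x‖ ^ 2 - ‖u‖ ^ 2) + ‖y + u‖ ^ 2 := by
  rw [norm_add_sq (𝕜 := ℂ)]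
  simp only [RCLike.re_to_complex]
  ring

/-- Only an upper bound on `-2 Re⟪u, v⟫` enters, so a sign condition can be exploited on one side
alone. -/
theorem re_inner_le_of_diag_le {b c a : ℝ} (hb0 : 0 ≤ b) (hb : b < 1)
    {x u v : X} (hu : ‖u‖ ≤ b * ‖x‖) (hv : ‖v‖ ≤ c * ‖x‖)
    (ha : -(2 * (⟪u, v⟫_ℂ).re) ≤ a * (‖x‖ ^ 2 - ‖u‖ ^ 2)) (y : X) :
    2 * (⟪y, v⟫_ℂ).re ≤ (a / 2 + √((a / 2) ^ 2 + c ^ 2 / (1 - b ^ 2))) *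
      (‖x‖ ^ 2 + ‖y‖ ^ 2 + 2 * (⟪y, u⟫_ℂ).re) := by
  have hb2 : 0 < 1 - b ^ 2 := by nlinarith
  have hu2 : ‖u‖ ^ 2 ≤ b ^ 2 * ‖x‖ ^ 2 := by
    rw [← mul_pow]; exact pow_le_pow_left₀ (norm_nonneg _) hu 2
  have hw : (1 - b ^ 2) * ‖x‖ ^ 2 ≤ ‖x‖ ^ 2 - ‖u‖ ^ 2 := by linarith
  have hw0 : 0 ≤ ‖x‖ ^ 2 - ‖u‖ ^ 2 := le_trans (by positivity) hw
  set w := √(‖x‖ ^ 2 - ‖u‖ ^ 2) with hwdef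
  have hw2 : w ^ 2 = ‖x‖ ^ 2 - ‖u‖ ^ 2 := Real.sq_sqrt hw0
  -- `‖v‖ ≤ c‖x‖`, and `hw` bounds `‖x‖` by `w / √(1 - b²)`.
  have hvw : ‖v‖ ≤ √(c ^ 2 / (1 - b ^ 2)) * w := by
    rw [← Real.sqrt_mul (by positivity)]
    apply Real.le_sqrt_of_sq_le
    calc ‖v‖ ^ 2 ≤ (c * ‖x‖) ^ 2 := pow_le_pow_left₀ (norm_nonneg _) hv 2
      _ = c ^ 2 / (1 - b ^ 2) * ((1 - b ^ 2) * ‖x‖ ^ 2) := by field_simp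
      _ ≤ _ := by gcongr
  have hsplit : (⟪y, v⟫_ℂ).re = (⟪y + u, v⟫_ℂ).re - (⟪u, v⟫_ℂ).re := by
    rw [inner_add_left, Complex.add_re]; ring
  have hcs : (⟪y + u, v⟫_ℂ).re ≤ ‖y + u‖ * ‖v‖ := re_inner_le_norm (𝕜 := ℂ) _ _
  have hcs2 : ‖y + u‖ * ‖v‖ ≤ ‖y + u‖ * (√(c ^ 2 / (1 - b ^ 2)) * w) := by gcongr
  have hq := quadratic_le_eigenvalue a (c ^ 2 / (1 - b ^ 2)) w ‖y + u‖ (by positivity)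
  rw [norm_sq_complete, hsplit]
  rw [hw2] at hq
  linarith

theorem abs_re_inner_le_of_abs_diag_le {b c a : ℝ} (hb0 : 0 ≤ b) (hb : b < 1)
    {x u v : X} (hu : ‖u‖ ≤ b * ‖x‖) (hv : ‖v‖ ≤ c * ‖x‖)
    (ha : |2 * (⟪u, v⟫_ℂ).re| ≤ a * (‖x‖ ^ 2 - ‖u‖ ^ 2)) (y : X) :
    |2 * (⟪y, v⟫_ℂ).re| ≤ (a / 2 + √((a / 2) ^ 2 + c ^ 2 / (1 - b ^ 2))) *
      (‖x‖ ^ 2 + ‖y‖ ^ 2 + 2 * (⟪y, u⟫_ℂ).re) := by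
  rw [abs_le] at ha
  refine abs_le'.mpr ⟨re_inner_le_of_diag_le hb0 hb hu hv (by linarith [ha.1]) y, ?_⟩
  -- The other sign is the same estimate for `-v`.
  have h := re_inner_le_of_diag_le hb0 hb hu (v := -v) (by rwa [norm_neg]) (a := a)
    (by simp only [inner_neg_right, Complex.neg_re]; linarith [ha.2]) y
  simp only [inner_neg_right, Complex.neg_re] at h
  linarith

theorem abs_diag_le {b c : ℝ} (hb0 : 0 ≤ b) (hb : b < 1) (hc : 0 ≤ c)
    {x u v : X} (hu : ‖u‖ ≤ b * ‖x‖) (hv : ‖v‖ ≤ c * ‖x‖) :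
    |2 * (⟪u, v⟫_ℂ).re| ≤ 2 * b * c / (1 - b ^ 2) * (‖x‖ ^ 2 - ‖u‖ ^ 2) := by
  have hb2 : 0 < 1 - b ^ 2 := by nlinarith
  have hu2 : ‖u‖ ^ 2 ≤ b ^ 2 * ‖x‖ ^ 2 := by
    rw [← mul_pow]; exact pow_le_pow_left₀ (norm_nonneg _) hu 2
  have h1 : |(⟪u, v⟫_ℂ).re| ≤ ‖u‖ * ‖v‖ := (Complex.abs_re_le_norm _).trans (norm_inner_le_norm u v)
  calc |2 * (⟪u, v⟫_ℂ).re| = 2 * |(⟪u, v⟫_ℂ).re| := by rw [abs_mul, abs_two]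
    _ ≤ 2 * ((b * ‖x‖) * (c * ‖x‖)) := by
        have : ‖u‖ * ‖v‖ ≤ (b * ‖x‖) * (c * ‖x‖) := by gcongr
        linarith
    _ = 2 * b * c / (1 - b ^ 2) * ((1 - b ^ 2) * ‖x‖ ^ 2) := by field_simp
    _ ≤ _ := by
        gcongr
        linarith

/-- The radicand is the perfect square `(c/(1-b²))²`, so the sum is `c(1+b)/(1-b²)`. -/
theorem eigenvalue_two_mul {b c : ℝ} (hb0 : 0 ≤ b) (hb : b < 1) (hc : 0 ≤ c) :
    (2 * b * c / (1 - b ^ 2)) / 2 + √(((2 * b * c / (1 - b ^ 2)) / 2) ^ 2 + c ^ 2 / (1 - b ^ 2))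
      = c / (1 - b) := by
  have hb2 : 0 < 1 - b ^ 2 := by nlinarith
  have h1 : 0 < 1 - b := by linarith
  have h2 : ((2 * b * c / (1 - b ^ 2)) / 2) ^ 2 + c ^ 2 / (1 - b ^ 2) = (c / (1 - b ^ 2)) ^ 2 := by
    field_simp
    ring
  rw [h2, Real.sqrt_sq (by positivity), show 1 - b ^ 2 = (1 - b) * (1 + b) by ring]
  have h3 : 0 < 1 + b := by linarith
  field_simp
  ring

theorem eigenvalue_zero {b c : ℝ} (hc : 0 ≤ c) :
    (0 : ℝ) / 2 + √(((0 : ℝ) / 2) ^ 2 + c ^ 2 / (1 - b ^ 2)) = c / √(1 - b ^ 2) := by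
  rw [zero_div, zero_add, zero_pow two_ne_zero, zero_add, Real.sqrt_div (sq_nonneg c),
    Real.sqrt_sq hc]

/-! ### The operator `diagBlock` as a quadratic form -/

section DiagBlock

variable [CompleteSpace X]

theorem re_inner_one_sub_star_mul_self (A : X →L[ℂ] X) (x : X) :
    (⟪x, (1 - star A * A) x⟫_ℂ).re = ‖x‖ ^ 2 - ‖A x‖ ^ 2 := by
  have h : ⟪x, (1 - star A * A) x⟫_ℂ = ⟪x, x⟫_ℂ - ⟪A x, A x⟫_ℂ := by
    rw [← ContinuousLinearMap.adjoint_inner_right A x (A x), ← inner_sub_right]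
    rfl
  rw [h, inner_self_eq_norm_sq_to_K, inner_self_eq_norm_sq_to_K, Complex.sub_re]
  norm_cast

/-- Invertibility comes from the Neumann series; it is what makes the negative power below a genuine
inverse square root. -/
theorem isStrictlyPositive_one_sub {A : X →L[ℂ] X} (hA : ‖A‖ < 1) :
    IsStrictlyPositive (1 - star A * A) := by
  have hn : ‖star A * A‖ < 1 := by
    rw [CStarRing.norm_star_mul_self]
    nlinarith [norm_nonneg A]
  refine ⟨?_, isUnit_one_sub_of_norm_lt_one hn⟩
  rw [ContinuousLinearMap.nonneg_iff_isPositive, ContinuousLinearMap.isPositive_def']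
  refine ⟨(IsSelfAdjoint.one _).sub (IsSelfAdjoint.star_mul_self A), fun x => ?_⟩
  rw [ContinuousLinearMap.reApplyInnerSelf_apply, inner_re_symm]
  change 0 ≤ (⟪x, (1 - star A * A) x⟫_ℂ).re
  rw [re_inner_one_sub_star_mul_self]
  have h1 : ‖A x‖ ≤ ‖x‖ := (A.le_opNorm x).trans
    (mul_le_of_le_one_left (norm_nonneg x) hA.le)
  nlinarith [norm_nonneg (A x)]

theorem isSelfAdjoint_rpow (T : X →L[ℂ] X) (s : ℝ) : IsSelfAdjoint (T ^ s) :=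
  IsSelfAdjoint.of_nonneg CFC.rpow_nonneg

theorem isSelfAdjoint_diagBlock (A δA : X →L[ℂ] X) : IsSelfAdjoint (diagBlock A δA) := by
  rw [diagBlock, IsSelfAdjoint, star_neg, star_mul, star_mul, (isSelfAdjoint_rpow _ _).star_eq,
    star_add, star_mul, star_mul, star_star, star_star, mul_assoc, add_comm]

theorem re_inner_symmetrized (A δA : X →L[ℂ] X) (x : X) :
    (⟪x, (star δA * A + star A * δA) x⟫_ℂ).re = 2 * (⟪A x, δA x⟫_ℂ).re := by
  have h : ⟪x, (star δA * A + star A * δA) x⟫_ℂ = ⟪δA x, A x⟫_ℂ + ⟪A x, δA x⟫_ℂ := by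
    rw [← ContinuousLinearMap.adjoint_inner_right A x (δA x),
      ← ContinuousLinearMap.adjoint_inner_right δA x (A x), ← inner_add_right]
    rfl
  have h2 : (⟪δA x, A x⟫_ℂ).re = (⟪A x, δA x⟫_ℂ).re := inner_re_symm (𝕜 := ℂ) _ _
  rw [h, Complex.add_re, h2]
  ring

theorem re_inner_diagBlock (A δA : X →L[ℂ] X) (w : X) :
    (⟪w, diagBlock A δA w⟫_ℂ).re =
      -(2 * (⟪A (((1 - star A * A) ^ (-(1 / 2) : ℝ) : X →L[ℂ] X) w),
        δA (((1 - star A * A) ^ (-(1 / 2) : ℝ) : X →L[ℂ] X) w)⟫_ℂ).re) := by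
  set R : X →L[ℂ] X := (1 - star A * A) ^ (-(1 / 2) : ℝ) with hR
  have hsa : ContinuousLinearMap.adjoint R = R := (isSelfAdjoint_rpow _ _).star_eq
  have h : ⟪w, diagBlock A δA w⟫_ℂ = -⟪R w, (star δA * A + star A * δA) (R w)⟫_ℂ := by
    rw [← ContinuousLinearMap.adjoint_inner_right R, hsa, ← inner_neg_right]
    rfl
  rw [h, Complex.neg_re, re_inner_symmetrized]

theorem norm_sq_rpow_neg_half {A : X →L[ℂ] X} (hA : ‖A‖ < 1) (w : X) :
    ‖((1 - star A * A) ^ (-(1 / 2) : ℝ) : X →L[ℂ] X) w‖ ^ 2 -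
      ‖A (((1 - star A * A) ^ (-(1 / 2) : ℝ) : X →L[ℂ] X) w)‖ ^ 2 = ‖w‖ ^ 2 := by
  have hsp := isStrictlyPositive_one_sub hA
  rw [← re_inner_one_sub_star_mul_self]
  set R : X →L[ℂ] X := (1 - star A * A) ^ (-(1 / 2) : ℝ) with hR
  have hsa : ContinuousLinearMap.adjoint R = R := (isSelfAdjoint_rpow _ _).star_eq
  have hid : R * (1 - star A * A) * R = 1 := CFC.conjugate_rpow_neg_one_half _ hsp
  have h : ⟪R w, (1 - star A * A) (R w)⟫_ℂ = ⟪w, w⟫_ℂ := by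
    rw [← ContinuousLinearMap.adjoint_inner_right R, hsa]
    exact congrArg (fun T : X →L[ℂ] X => ⟪w, T w⟫_ℂ) hid
  rw [h, inner_self_eq_norm_sq_to_K]
  norm_cast

theorem exists_rpow_neg_half_eq {A : X →L[ℂ] X} (hA : ‖A‖ < 1) (x : X) :
    ∃ w, ((1 - star A * A) ^ (-(1 / 2) : ℝ) : X →L[ℂ] X) w = x :=
  ⟨((1 - star A * A) ^ (1 / 2 : ℝ) : X →L[ℂ] X) x,
    congrArg (fun T : X →L[ℂ] X => T x)
      (CFC.rpow_neg_mul_rpow (1 / 2 : ℝ) (isStrictlyPositive_one_sub hA))⟩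

omit [CompleteSpace X] in
theorem re_inner_smul_one (a : ℝ) (w : X) :
    (⟪w, ((a : ℂ) • (1 : X →L[ℂ] X)) w⟫_ℂ).re = a * ‖w‖ ^ 2 := by
  have h : ⟪w, ((a : ℂ) • (1 : X →L[ℂ] X)) w⟫_ℂ = (a : ℂ) * ⟪w, w⟫_ℂ := inner_smul_right _ _ _
  rw [h, inner_self_eq_norm_sq_to_K, Complex.re_ofReal_mul]
  norm_cast

theorem le_iff_re_inner_le {S T : X →L[ℂ] X} (hS : IsSelfAdjoint S) (hT : IsSelfAdjoint T) :
    S ≤ T ↔ ∀ w, (⟪w, S w⟫_ℂ).re ≤ (⟪w, T w⟫_ℂ).re := by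
  rw [ContinuousLinearMap.le_def, ContinuousLinearMap.isPositive_def']
  refine ⟨fun h w => ?_, fun h => ⟨hT.sub hS, fun w => ?_⟩⟩
  · have h1 := h.2 w
    rw [ContinuousLinearMap.reApplyInnerSelf_apply, inner_re_symm, sub_apply,
      inner_sub_right, map_sub] at h1
    exact sub_nonneg.mp h1
  · rw [ContinuousLinearMap.reApplyInnerSelf_apply, inner_re_symm, sub_apply,
      inner_sub_right, map_sub]
    exact sub_nonneg.mpr (h w)

theorem isSelfAdjoint_real_smul_one (a : ℝ) : IsSelfAdjoint ((a : ℂ) • (1 : X →L[ℂ] X)) := by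
  rw [IsSelfAdjoint, star_smul, star_one, Complex.star_def, Complex.conj_ofReal]

/-- Two-sided bounds for `diagBlock` in terms of the untransformed vectors. -/
theorem diagBlock_bounds_iff {A : X →L[ℂ] X} (hA : ‖A‖ < 1) (δA : X →L[ℂ] X) (a : ℝ) :
    (-((a : ℂ) • (1 : X →L[ℂ] X)) ≤ diagBlock A δA ∧
      diagBlock A δA ≤ (a : ℂ) • (1 : X →L[ℂ] X)) ↔
    ∀ x, |2 * (⟪A x, δA x⟫_ℂ).re| ≤ a * (‖x‖ ^ 2 - ‖A x‖ ^ 2) := by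
  have hs := isSelfAdjoint_real_smul_one (X := X) a
  rw [le_iff_re_inner_le hs.neg (isSelfAdjoint_diagBlock A δA),
    le_iff_re_inner_le (isSelfAdjoint_diagBlock A δA) hs, ← forall_and]
  constructor
  · intro h x
    -- `(1 - A⋆A)^{-1/2}` is onto, so testing on all `w` tests on all `x`.
    obtain ⟨w, rfl⟩ := exists_rpow_neg_half_eq hA x
    have h1 := h w
    rw [neg_apply, inner_neg_right, Complex.neg_re, re_inner_smul_one,
      re_inner_diagBlock] at h1
    rw [norm_sq_rpow_neg_half hA, abs_le]
    exact ⟨by linarith [h1.2], by linarith [h1.1]⟩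
  · intro h w
    have h1 := h (((1 - star A * A) ^ (-(1 / 2) : ℝ) : X →L[ℂ] X) w)
    rw [norm_sq_rpow_neg_half hA, abs_le] at h1
    rw [neg_apply, inner_neg_right, Complex.neg_re, re_inner_smul_one,
      re_inner_diagBlock]
    exact ⟨by linarith [h1.2], by linarith [h1.1]⟩

end DiagBlock
end KleinGordon

namespace KleinGordon

/-! ### The forms in terms of `A` and `U^{1/2}ψ` -/

section Forms

variable {X : Type*} [NormedAddCommGroup X] [InnerProductSpace ℂ X] [CompleteSpace X]
variable {U V W : X →ₗ.[ℂ] X}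

/-- Since `U^{-1/2} = U⁻¹U^{1/2}` on the form domain, the forms involve `V` only through the bounded
operator `V U⁻¹`. -/
theorem apply_invSqrtU (hU : IsPosDef U) (hV : IsPotential U V) (x : (sqrtU hU).domain) :
    V ⟨invSqrtU hU x, hV.dom (invSqrtU_mem hU x)⟩ = relOp hU hV (sqrtU hU x) := by
  have h : invU hU (sqrtU hU x) = invSqrtU hU x := by
    rw [← invSqrtU_invSqrtU, invSqrtU_sqrtU]
  rw [relOp_apply]
  exact congrArg V (Subtype.ext h.symm)

theorem freeForm_symm (hU : IsPosDef U) (ψ φ : FormDom hU) :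
    freeForm hU ψ φ = star (freeForm hU φ ψ) := by
  simp only [freeForm, star_add, Complex.star_def, inner_conj_symm]

theorem potForm_symm (hU : IsPosDef U) (hV : IsPotential U V) (ψ φ : FormDom hU) :
    potForm hU hV ψ φ = star (potForm hU hV φ ψ) := by
  simp only [potForm, star_add, Complex.star_def, inner_conj_symm]
  rw [add_comm]

theorem kgForm_symm (hU : IsPosDef U) (hV : IsPotential U V) (ψ φ : FormDom hU) :
    kgForm hU hV ψ φ = star (kgForm hU hV φ ψ) := by
  rw [kgForm, kgForm, star_add, ← freeForm_symm, ← potForm_symm]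

theorem kgForm_add (hU : IsPosDef U) (hV : IsPotential U V) (hW : IsPotential U W)
    (ψ φ : FormDom hU) :
    kgForm hU (hV.add hW) ψ φ = kgForm hU hV ψ φ + potForm hU hW ψ φ := by
  have h : potForm hU (hV.add hW) ψ φ = potForm hU hV ψ φ + potForm hU hW ψ φ := by
    simp only [potForm, LinearPMap.add_apply, inner_add_left, inner_add_right]
    ring
  rw [kgForm, kgForm, h, add_assoc]

theorem potForm_diag_re (hU : IsPosDef U) (hV : IsPotential U V) (ψ : FormDom hU) :
    (potForm hU hV ψ ψ).re = 2 * (⟪sqrtU hU ψ.2, relOp hU hV (sqrtU hU ψ.1)⟫_ℂ).re := by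
  rw [potForm, apply_invSqrtU hU hV, Complex.add_re]
  have h : (⟪relOp hU hV (sqrtU hU ψ.1), sqrtU hU ψ.2⟫_ℂ).re =
    (⟪sqrtU hU ψ.2, relOp hU hV (sqrtU hU ψ.1)⟫_ℂ).re := inner_re_symm (𝕜 := ℂ) _ _
  rw [h]
  ring

theorem freeForm_diag_re (hU : IsPosDef U) (ψ : FormDom hU) :
    (freeForm hU ψ ψ).re = ‖sqrtU hU ψ.1‖ ^ 2 + ‖sqrtU hU ψ.2‖ ^ 2 := by
  rw [freeForm, inner_self_eq_norm_sq_to_K, inner_self_eq_norm_sq_to_K, Complex.add_re]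
  norm_cast

theorem kgForm_diag_re (hU : IsPosDef U) (hV : IsPotential U V) (ψ : FormDom hU) :
    (kgForm hU hV ψ ψ).re = ‖sqrtU hU ψ.1‖ ^ 2 + ‖sqrtU hU ψ.2‖ ^ 2 +
      2 * (⟪sqrtU hU ψ.2, relOp hU hV (sqrtU hU ψ.1)⟫_ℂ).re := by
  rw [kgForm, Complex.add_re, freeForm_diag_re, potForm_diag_re]

theorem sqrtU_eq_zero (hU : IsPosDef U) {x : (sqrtU hU).domain} (h : sqrtU hU x = 0) : x = 0 := by
  have h1 := invSqrtU_sqrtU hU x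
  rw [h, map_zero] at h1
  exact Subtype.ext h1.symm

theorem kgForm_pos (hU : IsPosDef U) (hV : IsPotential U V) (hA : ‖relOp hU hV‖ < 1)
    {ψ : FormDom hU} (hψ : ψ ≠ 0) : 0 < (kgForm hU hV ψ ψ).re := by
  rw [kgForm_diag_re, norm_sq_complete]
  have hu : ‖relOp hU hV (sqrtU hU ψ.1)‖ ≤ ‖relOp hU hV‖ * ‖sqrtU hU ψ.1‖ :=
    ContinuousLinearMap.le_opNorm _ _
  -- The strict inequality `‖A x‖ < ‖x‖` needs `x ≠ 0`; for `x = 0` the form reduces to `‖y‖²`.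
  by_cases hx : sqrtU hU ψ.1 = 0
  · rw [hx, map_zero, norm_zero, add_zero, sub_self, zero_add]
    have hy : sqrtU hU ψ.2 ≠ 0 := fun hy =>
      hψ (Prod.ext (sqrtU_eq_zero hU hx) (sqrtU_eq_zero hU hy))
    have := norm_pos_iff.mpr hy
    positivity
  · have h0 := norm_pos_iff.mpr hx
    have h1 : ‖relOp hU hV (sqrtU hU ψ.1)‖ < ‖sqrtU hU ψ.1‖ :=
      hu.trans_lt (mul_lt_of_lt_one_left h0 hA)
    have h2 := pow_lt_pow_left₀ h1 (norm_nonneg _) two_ne_zero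
    have h3 := sq_nonneg ‖sqrtU hU ψ.2 + relOp hU hV (sqrtU hU ψ.1)‖
    linarith

end Forms

/-! ### Small perturbations and their constants -/

section Abstract

theorem norm_diag_eq_abs_re {z : ℂ} (h : z = star z) : ‖z‖ = |z.re| :=
  Complex.abs_re_eq_norm.mpr (Complex.conj_eq_iff_im.mp h.symm) |>.symm

theorem smallPert_of_abs_re_le {Q : Type*} {δg g : Q → Q → ℂ} {κ : ℝ} (hκ : κ < 1)
    (hs : ∀ ψ, δg ψ ψ = star (δg ψ ψ)) (h : ∀ ψ, |(δg ψ ψ).re| ≤ κ * (g ψ ψ).re) :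
    SmallPert δg g κ :=
  ⟨hκ, fun ψ => (norm_diag_eq_abs_re (hs ψ)).trans_le (h ψ)⟩

theorem abs_formRatio_le {Q : Type*} {δg g : Q → Q → ℂ} {κ : ℝ} {ψ : Q}
    (hg : 0 < (g ψ ψ).re) (h : |(δg ψ ψ).re| ≤ κ * (g ψ ψ).re) : |formRatio δg g ψ| ≤ κ := by
  rw [formRatio, abs_div, abs_of_pos hg]
  exact (div_le_iff₀ hg).mpr h

/-- Shifting a form by the midpoint of its relative bounds makes the bounds symmetric. -/
theorem smallPert_shift {Q : Type*} {δg g : Q → Q → ℂ} {κm κp κ₀ κ' : ℝ}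
    (hsδ : ∀ ψ, δg ψ ψ = star (δg ψ ψ)) (hs : ∀ ψ, g ψ ψ = star (g ψ ψ))
    (hm : ∀ ψ, κm * (g ψ ψ).re ≤ (δg ψ ψ).re) (hp : ∀ ψ, (δg ψ ψ).re ≤ κp * (g ψ ψ).re)
    (hκm : -1 < κm) (hκ₀ : κ₀ = (κp + κm) / 2) (hκ₀pos : 0 ≤ κ₀)
    (hκ' : κ' = (κp - κm) / (2 + κp + κm)) :
    SmallPert (fun ψ φ => δg ψ φ - κ₀ * g ψ φ) (fun ψ φ => (1 + κ₀) * g ψ φ) κ' := by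
  have hden : 0 < 2 + κp + κm := by linarith
  refine smallPert_of_abs_re_le ?_ (fun ψ => ?_) (fun ψ => ?_)
  -- `κ' < 1` amounts to `κm > -1`.
  · rw [hκ', div_lt_one hden]
    linarith
  · rw [star_sub, star_mul', ← hs ψ, ← hsδ ψ, Complex.star_def, Complex.conj_ofReal]
  · have h1 : ((1 + (κ₀ : ℂ)) * g ψ ψ).re = (1 + κ₀) * (g ψ ψ).re := by
      rw [← Complex.ofReal_one, ← Complex.ofReal_add, Complex.re_ofReal_mul]
    -- As `1 + κ₀ = (2 + κp + κm)/2`, the product `κ'(1 + κ₀)` is half the width of `[κm, κp]`.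
    have h2 : κ' * ((1 + κ₀) * (g ψ ψ).re) = (κp - κm) / 2 * (g ψ ψ).re := by
      rw [hκ', hκ₀]
      field_simp
      ring
    rw [h1, h2, Complex.sub_re, Complex.re_ofReal_mul, hκ₀, abs_le]
    constructor
    · linarith [hm ψ]
    · linarith [hp ψ]

/-- All follows from `(1-b)² ≤ 1 - b²` and `κp(2 + κp + κm) - (κp - κm) = (κp + κm)(1 + κp)`. -/
theorem shift_constants {b c κm κp κ₀ κ' : ℝ} (hb0 : 0 ≤ b) (hb : b < 1) (hc : 0 ≤ c)
    (hm : κm = -(c / √(1 - b ^ 2))) (hp : κp = c / (1 - b)) (h₀ : κ₀ = (κp + κm) / 2)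
    (h' : κ' = (κp - κm) / (2 + κp + κm)) :
    0 ≤ κ₀ ∧ κ' ≤ κp ∧ (0 < b → 0 < c → κ₀ ≠ 0 ∧ κ' < κp) := by
  have h1 : 0 < 1 - b := by linarith
  have hle : 1 - b ≤ √(1 - b ^ 2) := Real.le_sqrt_of_sq_le (by nlinarith)
  have hκ0 : 0 ≤ κp + κm := by
    rw [hm, hp, ← sub_eq_add_neg, sub_nonneg]
    exact div_le_div_of_nonneg_left hc h1 hle
  have hκp : 0 ≤ κp := hp ▸ div_nonneg hc h1.le
  have hden : 0 < 2 + κp + κm := by linarith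
  refine ⟨by linarith, ?_, fun hb' hc' => ?_⟩
  · rw [h', div_le_iff₀ hden]
    nlinarith [mul_nonneg hκ0 (show 0 ≤ 1 + κp by linarith)]
  · have hlt : 1 - b < √(1 - b ^ 2) := Real.lt_sqrt_of_sq_lt (by nlinarith)
    have hκ : 0 < κp + κm := by
      rw [hm, hp, ← sub_eq_add_neg, sub_pos]
      exact div_lt_div_of_pos_left hc' h1 hlt
    refine ⟨by rw [h₀]; positivity, ?_⟩
    rw [h', div_lt_iff₀ hden]
    nlinarith [mul_pos hκ (show 0 < 1 + κp by linarith)]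

theorem div_sqrt_lt_one_iff {b c : ℝ} (hb0 : 0 ≤ b) (hb : b < 1) (hc : 0 ≤ c) :
    c / √(1 - b ^ 2) < 1 ↔ b ^ 2 + c ^ 2 < 1 := by
  have hb2 : 0 < 1 - b ^ 2 := by nlinarith
  rw [div_lt_one (Real.sqrt_pos.mpr hb2), Real.lt_sqrt hc]
  constructor <;> intro h <;> linarith

end Abstract

end KleinGordon

/-! ### Assembly of the estimates -/

theorem mainTheorem3 {X : Type*} [NormedAddCommGroup X] [InnerProductSpace ℂ X] [CompleteSpace X]
    (U V δV : X →ₗ.[ℂ] X) (hU : IsPosDef U) (hV : IsPotential U V) (hδV : IsPotential U δV)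
    (A δA : X →L[ℂ] X) (hAdef : A = relOp hU hV) (hδAdef : δA = relOp hU hδV)
    (g δg : FormDom hU → FormDom hU → ℂ) (hg : g = kgForm hU hV) (hδg : δg = potForm hU hδV)
    (b c : ℝ) (hA : ‖A‖ ≤ b) (hδA : ‖δA‖ ≤ c) (hb : b < 1) :
    -- `g`, `δg` are symmetric, `g` is positive definite, `g + δg` is the form for `V + δV`
    ((∀ ψ φ, g ψ φ = star (g φ ψ)) ∧ (∀ ψ φ, δg ψ φ = star (δg φ ψ)) ∧
      (∀ ψ, ψ ≠ 0 → 0 < (g ψ ψ).re) ∧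
      (∀ ψ φ, kgForm hU (hV.add hδV) ψ φ = g ψ φ + δg ψ φ)) ∧
    -- the general bound, for any `a` bounding the diagonal block
    (∀ a : ℝ, -((a : ℂ) • (1 : X →L[ℂ] X)) ≤ diagBlock A δA →
      diagBlock A δA ≤ (a : ℂ) • (1 : X →L[ℂ] X) →
      ∀ ψ, ψ ≠ 0 → |formRatio δg g ψ| ≤ a / 2 + √((a / 2) ^ 2 + c ^ 2 / (1 - b ^ 2))) ∧
    -- the choice `a = 2bc/(1-b²)` is allowed and gives `c/(1-b)`, which is at most `c + b`
    (-(((2 * b * c / (1 - b ^ 2) : ℝ) : ℂ) • (1 : X →L[ℂ] X)) ≤ diagBlock A δA ∧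
      diagBlock A δA ≤ ((2 * b * c / (1 - b ^ 2) : ℝ) : ℂ) • (1 : X →L[ℂ] X) ∧
      (2 * b * c / (1 - b ^ 2)) / 2 + √(((2 * b * c / (1 - b ^ 2)) / 2) ^ 2 + c ^ 2 / (1 - b ^ 2))
        = c / (1 - b) ∧
      (∀ ψ, ψ ≠ 0 → |formRatio δg g ψ| ≤ c / (1 - b)) ∧
      (b + c < 1 → c / (1 - b) ≤ c + b ∧ SmallPert δg g (c / (1 - b)) ∧
        SmallPert δg g (c + b))) ∧
    -- `δV` measured by `V`
    (∀ ν : ℝ, 0 ≤ ν →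
      (∀ ψ : U.domain, ‖δV ⟨ψ, hδV.dom ψ.2⟩‖ ≤ ν * ‖V ⟨ψ, hV.dom ψ.2⟩‖) →
      (∀ ψ, ψ ≠ 0 → |formRatio δg g ψ| ≤ ν * b / (1 - b)) ∧
      (ν * b / (1 - b) < 1 ↔ b + ν * b < 1) ∧
      (b + ν * b < 1 → SmallPert δg g (ν * b / (1 - b)))) ∧
    -- `V` and `δV` with disjoint supports
    ((∀ ψ : U.domain, ⟪V ⟨ψ, hV.dom ψ.2⟩, δV ⟨ψ, hδV.dom ψ.2⟩⟫_ℂ = 0) →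
      (∀ ψ, ψ ≠ 0 → |formRatio δg g ψ| ≤ c / √(1 - b ^ 2)) ∧
      (c / √(1 - b ^ 2) < 1 ↔ b ^ 2 + c ^ 2 < 1) ∧
      (b ^ 2 + c ^ 2 < 1 → SmallPert δg g (c / √(1 - b ^ 2)))) ∧
    -- `V δV ≤ 0`: one-sided bounds, and the improved bound after rescaling by `1 + κ₀`
    (star δA * A + star A * δA ≤ 0 →
      (∀ ψ, ψ ≠ 0 → -(c / √(1 - b ^ 2)) ≤ formRatio δg g ψ ∧ formRatio δg g ψ ≤ c / (1 - b)) ∧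
      (∀ κm κp κ₀ κ' : ℝ, κm = -(c / √(1 - b ^ 2)) → κp = c / (1 - b) → κ₀ = (κp + κm) / 2 →
        κ' = (κp - κm) / (2 + κp + κm) →
        0 ≤ κ₀ ∧ κ' ≤ κp ∧ (0 < b → 0 < c → κ₀ ≠ 0 ∧ κ' < κp) ∧
        (b ^ 2 + c ^ 2 < 1 → SmallPert (fun ψ φ => δg ψ φ - κ₀ * g ψ φ)
          (fun ψ φ => (1 + κ₀) * g ψ φ) κ'))) := by
  subst hAdef hδAdef hg hδg
  set A := relOp hU hV with hAset
  set δA := relOp hU hδV with hδAset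
  have hb0 : 0 ≤ b := (norm_nonneg A).trans hA
  have hc0 : 0 ≤ c := (norm_nonneg δA).trans hδA
  have hA1 : ‖A‖ < 1 := hA.trans_lt hb
  have h1b : 0 < 1 - b := by linarith
  have hu : ∀ x, ‖A x‖ ≤ b * ‖x‖ := A.le_of_opNorm_le hA
  have hv : ∀ x, ‖δA x‖ ≤ c * ‖x‖ := δA.le_of_opNorm_le hδA
  have hpos : ∀ ψ, ψ ≠ 0 → 0 < (kgForm hU hV ψ ψ).re := fun ψ hψ => kgForm_pos hU hV hA1 hψ
  have hsδ : ∀ ψ, potForm hU hδV ψ ψ = star (potForm hU hδV ψ ψ) :=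
    fun ψ => potForm_symm hU hδV ψ ψ
  -- The bound `d` on `δA` is kept free of `c`, so that `d = νb` can be used when `δV` is measured
  -- by `V`.
  have bound : ∀ a d : ℝ, (∀ x, ‖δA x‖ ≤ d * ‖x‖) →
      (∀ x, |2 * (⟪A x, δA x⟫_ℂ).re| ≤ a * (‖x‖ ^ 2 - ‖A x‖ ^ 2)) → ∀ ψ,
      |(potForm hU hδV ψ ψ).re| ≤
        (a / 2 + √((a / 2) ^ 2 + d ^ 2 / (1 - b ^ 2))) * (kgForm hU hV ψ ψ).re := by
    intro a d hd ha ψ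
    rw [potForm_diag_re, kgForm_diag_re]
    exact abs_re_inner_le_of_abs_diag_le hb0 hb (hu _) (hd _) (ha _) _
  have bound' : ∀ d : ℝ, 0 ≤ d → (∀ x, ‖δA x‖ ≤ d * ‖x‖) → ∀ ψ,
      |(potForm hU hδV ψ ψ).re| ≤ d / (1 - b) * (kgForm hU hV ψ ψ).re := by
    intro d hd0 hd ψ
    rw [← eigenvalue_two_mul hb0 hb hd0]
    exact bound _ d hd (fun x => abs_diag_le hb0 hb hd0 (hu x) (hd x)) ψ
  have hD := (diagBlock_bounds_iff hA1 δA (2 * b * c / (1 - b ^ 2))).mpr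
    fun x => abs_diag_le hb0 hb hc0 (hu x) (hv x)
  refine ⟨⟨kgForm_symm hU hV, potForm_symm hU hδV, hpos, kgForm_add hU hV hδV⟩, ?_,
    ⟨hD.1, hD.2, eigenvalue_two_mul hb0 hb hc0, ?_, ?_⟩, ?_, ?_, ?_⟩
  · intro a ha1 ha2 ψ hψ
    exact abs_formRatio_le (hpos ψ hψ)
      (bound a c hv ((diagBlock_bounds_iff hA1 δA a).mp ⟨ha1, ha2⟩) ψ)
  · exact fun ψ hψ => abs_formRatio_le (hpos ψ hψ) (bound' c hc0 hv ψ)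
  · intro hbc
    have hle : c / (1 - b) ≤ c + b := by
      rw [div_le_iff₀ h1b]
      -- `(c + b)(1 - b) - c = b(1 - b - c)`.
      nlinarith [mul_nonneg hb0 (show 0 ≤ 1 - b - c by linarith)]
    refine ⟨hle, smallPert_of_abs_re_le (by linarith) hsδ (bound' c hc0 hv),
      smallPert_of_abs_re_le (by linarith) hsδ fun ψ => ?_⟩
    refine (bound' c hc0 hv ψ).trans (mul_le_mul_of_nonneg_right hle ?_)
    by_cases hψ : ψ = 0
    · simp [hψ, kgForm_diag_re]
    · exact (hpos ψ hψ).le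
  · intro ν hν h
    have hd : ∀ x, ‖δA x‖ ≤ ν * b * ‖x‖ := fun x => by
      rw [mul_assoc]
      exact (h ⟨invU hU x, invU_mem hU x⟩).trans (mul_le_mul_of_nonneg_left (hu x) hν)
    have hiff : ν * b / (1 - b) < 1 ↔ b + ν * b < 1 := by
      rw [div_lt_one h1b]
      constructor <;> intro h <;> linarith
    have hbd := bound' (ν * b) (by positivity) hd
    exact ⟨fun ψ hψ => abs_formRatio_le (hpos ψ hψ) (hbd ψ), hiff,
      fun h1 => smallPert_of_abs_re_le (hiff.mpr h1) hsδ hbd⟩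
  · intro h
    have hz : ∀ x, |2 * (⟪A x, δA x⟫_ℂ).re| ≤ 0 * (‖x‖ ^ 2 - ‖A x‖ ^ 2) := fun x => by
      have h0 : ⟪A x, δA x⟫_ℂ = 0 := h ⟨invU hU x, invU_mem hU x⟩
      rw [h0, Complex.zero_re, mul_zero, abs_zero, zero_mul]
    have hbd := bound 0 c hv hz
    rw [eigenvalue_zero hc0] at hbd
    have hiff := div_sqrt_lt_one_iff hb0 hb hc0
    exact ⟨fun ψ hψ => abs_formRatio_le (hpos ψ hψ) (hbd ψ), hiff,
      fun h1 => smallPert_of_abs_re_le (hiff.mpr h1) hsδ hbd⟩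
  · intro hneg
    have hdiag : ∀ x, (⟪A x, δA x⟫_ℂ).re ≤ 0 := fun x => by
      have h1 := (ContinuousLinearMap.le_def _ _).mp hneg
      have h2 : 0 ≤ (⟪x, (0 - (star δA * A + star A * δA)) x⟫_ℂ).re :=
        h1.re_inner_nonneg_right x
      rw [zero_sub, neg_apply, inner_neg_right, Complex.neg_re, re_inner_symmetrized] at h2
      linarith
    have hlow : ∀ ψ, -(c / √(1 - b ^ 2)) * (kgForm hU hV ψ ψ).re ≤ (potForm hU hδV ψ ψ).re := by
      intro ψ
      rw [potForm_diag_re, kgForm_diag_re, ← eigenvalue_zero hc0]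
      -- For `-δA` the diagonal term is `2 Re⟪A x, δA x⟫ ≤ 0`, which permits `a = 0`; the upper
      -- bound `hup` is the general one.
      have h1 := re_inner_le_of_diag_le hb0 hb (hu (sqrtU hU ψ.1)) (v := -δA (sqrtU hU ψ.1))
        (by rw [norm_neg]; exact hv _) (a := 0)
        (by simp only [inner_neg_right, Complex.neg_re]; linarith [hdiag (sqrtU hU ψ.1)])
        (sqrtU hU ψ.2)
      simp only [inner_neg_right, Complex.neg_re] at h1
      linarith
    have hup : ∀ ψ, (potForm hU hδV ψ ψ).re ≤ c / (1 - b) * (kgForm hU hV ψ ψ).re :=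
      fun ψ => (le_abs_self _).trans (bound' c hc0 hv ψ)
    refine ⟨fun ψ hψ => ⟨(le_div_iff₀ (hpos ψ hψ)).mpr (hlow ψ),
      (div_le_iff₀ (hpos ψ hψ)).mpr (hup ψ)⟩, fun κm κp κ₀ κ' hm hp h₀ h' => ?_⟩
    obtain ⟨r1, r2, r3⟩ := shift_constants hb0 hb hc0 hm hp h₀ h'
    refine ⟨r1, r2, r3, fun hbc => ?_⟩
    have hlt := (div_sqrt_lt_one_iff hb0 hb hc0).mpr hbc
    exact smallPert_shift hsδ (fun ψ => kgForm_symm hU hV ψ ψ) (hm ▸ hlow) (hp ▸ hup)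
      (by linarith) h₀ r1 h'
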